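/- Conventions. For a commutative ring $A$, a point $\alpha$ of the real spectrum $\mathrm{Spec}_r A$ is a pair $(\mathfrak p,\le_\alpha)$ with $\mathfrak p=\mathrm{supp}(\alpha)$ a prime ideal and $\le_\alpha$ an ordering of the fraction field of $A/\mathfrak p$; the topology of $\mathrm{Spec}_r A$ is generated by the sets $\{\alpha : a>_\alpha 0\}$, $a\in A$, and $\beta$ is a generization of $\alpha$ if $\alpha\in\overline{\{\beta\}}$. An element $a$ changes sign on $\mathrm{Spec}_r A$ if $a>_\alpha0$ and $a<_\beta0$ for some $\alpha,\beta\in\mathrm{Spec}_r A$. An irreducible $p\in A$ is called real if $-1$ is not a sum of squares in $A/(p)$, and non-real otherwise. A symmetric matrix $M$ over $A$ is positive semidefinite on $\mathrm{Spec}_r A$ if $\varphi(M)$ is positive semidefinite for every ring homomorphism $\varphi:A\to R$ into a real closed field $R$. Consider the conditions: (PNRI) Every non-real irreducible of $A$ is associated to a non-real irreducible $q'$ with $q'>_\alpha0$ for all $\alpha\in\mathrm{Spec}_r A$. (GRI) with respect to a real irreducible $p$: there are $\alpha,\beta\in\mathrm{Spec}_r A$ with $\mathrm{supp}(\alpha)=(p)$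 and $\mathrm{supp}(\beta)=(0)$ such that $\beta$ is a generization of $\alpha$. Theorem. Let $A$ be a regular unique factorization domain and let $M\in A^{n\times n}$ be a symmetric matrix that is positive semidefinite on $\mathrm{Spec}_r A$. Assume that $M$ admits a Smith normal form, i.e. there are $r\le n$, elements $d_1\mid d_2\mid\cdots\mid d_r$ of $A$ and matrices $P,Q\in A^{n\times n}$ whose determinants are units such that $M=P\,\mathrm{diag}(d_1,\dots,d_r,0,\dots,0)\,Q$. Assume furthermore that $A$ satisfies (PNRI), and that (GRI) holds with respect to every real irreducible $p$ that divides some $d_k$ and changes sign on $\mathrm{Spec}_r A$. Then for every $k=1,\dots,r$ the element $d_k$ is associated to an element $d'_k\in A$ that is positive on $\mathrm{Spec}_r A$ in the following sense: for all $\alpha\in\mathrm{Spec}_r A$ one has $d'_k\ge_\alpha0$, and $d'_k>_\alpha0$ whenever $d_k\notin\mathrm{supp}(\alpha)$. -/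

import Mathlib

universe u

/-- The real spectrum of a commutative ring: the set of its orderings (prime cones). A pair
`(𝔭, ≤)` of a prime ideal and an ordering of `A ⧸ 𝔭` (equivalently, of its fraction field)
corresponds to the set `P` of all `a` whose class is nonnegative, and `𝔭 = P ∩ -P`. -/
def RealSpectrum (A : Type u) [CommRing A] : Type u :=
  {P : RingPreordering A // P.IsOrdering}

namespace RealSpectrum

variable {A : Type u} [CommRing A]

instance (α : RealSpectrum A) : α.1.IsOrdering := α.2

/-- The support of a point, a prime ideal of `A`. -/
def supp (α : RealSpectrum A) : Ideal A := α.1.support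

/-- `a ≥ 0` at the point `α`. -/
def IsNonneg (α : RealSpectrum A) (a : A) : Prop := a ∈ α.1

/-- `a > 0` at the point `α`. -/
def IsPos (α : RealSpectrum A) (a : A) : Prop := a ∈ α.1 ∧ a ∉ α.supp

/-- The topology generated by the sets `{α | a > 0 at α}`, `a ∈ A`. In Mathlib's notation
`β ⤳ α` says that `α` lies in the closure of `{β}`, that is, `β` is a generization of `α`. -/
instance : TopologicalSpace (RealSpectrum A) :=
  TopologicalSpace.generateFrom {U | ∃ a : A, U = {α | α.IsPos a}}

end RealSpectrum

/-- `a` changes sign on the real spectrum: it is positive at some point, negative at another. -/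
def ChangesSign {A : Type u} [CommRing A] (a : A) : Prop :=
  ∃ α β : RealSpectrum A, α.IsPos a ∧ β.IsPos (-a)

/-- A real irreducible: `-1` is not a sum of squares in `A ⧸ (p)`
(this is Mathlib's `IsSemireal`). -/
def IsRealIrreducible {A : Type u} [CommRing A] (p : A) : Prop :=
  Irreducible p ∧ IsSemireal (A ⧸ Ideal.span {p})

/-- A non-real irreducible. -/
def IsNonRealIrreducible {A : Type u} [CommRing A] (q : A) : Prop :=
  Irreducible q ∧ ¬ IsSemireal (A ⧸ Ideal.span {q})

/-- Condition (PNRI): every non-real irreducible is associated to a non-real irreducible which is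
strictly positive on the whole real spectrum. -/
def PNRI (A : Type u) [CommRing A] : Prop :=
  ∀ q : A, IsNonRealIrreducible q →
    ∃ q' : A, Associated q q' ∧ IsNonRealIrreducible q' ∧ ∀ α : RealSpectrum A, α.IsPos q'

/-- Condition (GRI) with respect to `p`: some point with support `(p)` has a generization with
support `(0)`. -/
def GRI {A : Type u} [CommRing A] (p : A) : Prop :=
  ∃ α β : RealSpectrum A, α.supp = Ideal.span {p} ∧ β.supp = ⊥ ∧ β ⤳ α

/-- Positive semidefiniteness of a symmetric matrix on the real spectrum: its image under every
ring homomorphism into a real closed field is positive semidefinite. -/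
def IsPsdOnRealSpectrum {A : Type u} [CommRing A] {n : ℕ} (M : Matrix (Fin n) (Fin n) A) : Prop :=
  ∀ (R : Type u) [Field R] [LinearOrder R] [IsStrictOrderedRing R] [IsRealClosed R]
    (φ : A →+* R) (v : Fin n → R), 0 ≤ dotProduct v ((M.map φ).mulVec v)

/-- `M ∼ N`: `M = P N Q` for matrices `P`, `Q` whose determinants are units. -/
def MatrixEquivalent {A : Type u} [CommRing A] {n : ℕ} (M N : Matrix (Fin n) (Fin n) A) : Prop :=
  ∃ P Q : Matrix (Fin n) (Fin n) A, IsUnit P.det ∧ IsUnit Q.det ∧ M = P * N * Q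

/-- The `n × n` matrix `diag(d₁, …, d_r, 0, …, 0)`. -/
def diagZero {A : Type u} [CommRing A] (n : ℕ) {r : ℕ} (d : Fin r → A) :
    Matrix (Fin n) (Fin n) A :=
  Matrix.diagonal fun i => if h : (i : ℕ) < r then d ⟨i, h⟩ else 0

/-!
The values of a positive semidefinite form over `A` are sums of squares in the fraction field of
`A`: in a field `K` with `2 ≠ 0`, an element that is not a sum of squares is negative in some real
closed extension of `K` (Artin). On the other hand, if `(p)` is the support of a point of the real
spectrum, then a sum of squares in the fraction field has even order at `p`, because the leading
coefficients modulo `p` are nonnegative at that point and cannot cancel.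

Let `e` be a diagonal entry of the Smith normal form. The columns of `Q⁻¹` and the rows of `P⁻¹`
provide vectors `x`, `y` with `M(x, x) = e s`, `M(y, y) = e t` and `M(x, y) = e`, so that
`M(x + y, x + y) = e (s + t + 2)`. If `e` had odd order at `p`, then `p` would divide `s`, `t` and
`s + t + 2`, hence `2`, which is positive at every point. So the sign-changing real primes occur in
`e` to even powers, and every other prime can be replaced by an associate which is nonnegative
everywhere.
-/

section SumsOfSquares

theorem isSumSq_map {R S : Type*} [NonAssocSemiring R] [NonAssocSemiring S] (φ : R →+* S) {a : R}
    (ha : IsSumSq a) : IsSumSq (φ a) := by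
  induction ha with
  | zero => simp
  | sq_add x _ ih => simpa using IsSumSq.sq_add (φ x) ih

theorem isSemireal_of_ringHom {R S : Type*} [Ring R] [Ring S] [IsSemireal S] (φ : R →+* S) :
    IsSemireal R :=
  .of_not_isSumSq_neg_one fun h => IsSemireal.not_isSumSq_neg_one S (by simpa using isSumSq_map φ h)

theorem isSumSq_inv {F : Type*} [Semifield F] {a : F} (ha : IsSumSq a) : IsSumSq a⁻¹ := by
  have h : a⁻¹ = a * (a⁻¹ * a⁻¹) := by
    rcases eq_or_ne a 0 with rfl | h0
    · simp
    · field_simp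
  exact h ▸ ha.mul (.mul_self _)

variable {F : Type*} [Field F]

theorem isSemireal_of_not_isSumSq (h2 : (2 : F) ≠ 0) {b : F} (hb : ¬ IsSumSq b) : IsSemireal F := by
  refine .of_not_isSumSq_neg_one fun h => hb ?_
  have key : b = (b + 1) / 2 * ((b + 1) / 2) + -1 * ((b - 1) / 2 * ((b - 1) / 2)) := by
    field_simp
    ring
  exact key ▸ .sq_add _ (h.mul (.mul_self _))

theorem eq_zero_of_isSumSq_of_isSumSq_neg [IsSemireal F] {a : F} (ha : IsSumSq a)
    (hna : IsSumSq (-a)) : a = 0 := by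
  by_contra ha0
  have h : -a * a⁻¹ = -1 := by field_simp
  exact IsSemireal.not_isSumSq_neg_one F (h ▸ hna.mul (isSumSq_inv ha))

end SumsOfSquares

section AdjoinRoot

open Polynomial

theorem isSumSq_leadingCoeff_add {R : Type*} [Semiring R] {G H : R[X]}
    (hG : IsSumSq G.leadingCoeff) (hH : IsSumSq H.leadingCoeff)
    (h : G.leadingCoeff + H.leadingCoeff ≠ 0) : IsSumSq (G + H).leadingCoeff := by
  rcases lt_trichotomy G.degree H.degree with hlt | heq | hlt
  · rwa [leadingCoeff_add_of_degree_lt hlt]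
  · rw [leadingCoeff_add_of_degree_eq heq h]
    exact hG.add hH
  · rwa [leadingCoeff_add_of_degree_lt' hlt]

variable {F : Type*} [Field F]

theorem even_natDegree_and_isSumSq_leadingCoeff [IsSemireal F] {G : F[X]} (hG : IsSumSq G) :
    Even G.natDegree ∧ IsSumSq G.leadingCoeff := by
  induction hG with
  | zero => simp
  | @sq_add g G _ ih =>
    rcases eq_or_ne g 0 with rfl | hg
    · simpa using ih
    have hlead : IsSumSq (g * g).leadingCoeff := by simp
    have hsum : (g * g).leadingCoeff + G.leadingCoeff ≠ 0 := fun h => by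
      have h0 := eq_zero_of_isSumSq_of_isSumSq_neg hlead (eq_neg_of_add_eq_zero_right h ▸ ih.2)
      simp [hg] at h0
    refine ⟨?_, isSumSq_leadingCoeff_add hlead ih.2 hsum⟩
    have hdeg := degree_add_eq_of_leadingCoeff_add_ne_zero hsum
    rcases max_choice (g * g).degree G.degree with h | h <;>
      rw [natDegree_eq_of_degree_eq (hdeg.trans h)]
    · exact natDegree_mul hg hg ▸ ⟨_, rfl⟩
    · exact ih.1

theorem exists_isSumSq_mk_eq {f : F[X]} (hf : f.natDegree ≠ 0) {z : AdjoinRoot f}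
    (hz : IsSumSq z) :
    ∃ G : F[X], IsSumSq G ∧ G.natDegree < 2 * f.natDegree ∧ AdjoinRoot.mk f G = z := by
  induction hz with
  | zero => exact ⟨0, .zero, by simpa using Nat.pos_of_ne_zero hf, map_zero _⟩
  | sq_add x _ ih =>
    obtain ⟨G, hG, hdeg, rfl⟩ := ih
    obtain ⟨g, rfl⟩ := AdjoinRoot.mk_surjective x
    have hg : AdjoinRoot.mk f (g % f) = AdjoinRoot.mk f g := by
      conv_rhs => rw [← EuclideanDomain.mod_add_div g f]
      simp
    refine ⟨g % f * (g % f) + G, .sq_add _ hG, ?_, by simp [hg]⟩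
    have hmul : (g % f * (g % f)).natDegree < 2 * f.natDegree := by
      have := natDegree_mod_lt g hf
      have := natDegree_mul_le (p := g % f) (q := g % f)
      omega
    exact (natDegree_add_le _ _).trans_lt (max_lt hmul hdeg)

/-- Springer's argument: if `-1` is the sum of squares `∑ gᵢ²` modulo `f`, where `deg gᵢ < deg f`,
then `1 + ∑ gᵢ² = f * h` has even degree, so `h` has smaller odd degree than `f`, and `-1` is a sum
of squares modulo `h` as well. -/
theorem isSemireal_adjoinRoot_of_odd_natDegree [IsSemireal F] {f : F[X]} (hf : Odd f.natDegree) :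
    IsSemireal (AdjoinRoot f) := by
  induction hn : f.natDegree using Nat.strong_induction_on generalizing f with
  | h n ih =>
  subst hn
  refine .of_not_isSumSq_neg_one fun hneg => ?_
  obtain ⟨G, hG, hdeg, hGf⟩ := exists_isSumSq_mk_eq hf.pos.ne' hneg
  obtain ⟨h, hh⟩ : f ∣ G + 1 := by
    rw [← AdjoinRoot.mk_eq_zero, map_add, hGf, map_one, neg_add_cancel]
  have hG1 : G + 1 ≠ 0 := fun h0 => by
    have := isSumSq_map (evalRingHom 0) (eq_neg_of_add_eq_zero_left h0 ▸ hG)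
    exact IsSemireal.not_isSumSq_neg_one F (by rwa [map_neg, map_one] at this)
  have heven : Even (G + 1).natDegree :=
    (even_natDegree_and_isSumSq_leadingCoeff (hG.add .one)).1
  have hlt : (G + 1).natDegree < 2 * f.natDegree := by rwa [← C_1, natDegree_add_C]
  rw [hh, natDegree_mul (left_ne_zero_of_mul (hh ▸ hG1)) (right_ne_zero_of_mul (hh ▸ hG1))]
    at heven hlt
  have hodd : Odd h.natDegree := Nat.not_even_iff_odd.1 fun he =>
    Nat.not_even_iff_odd.2 hf ((Nat.even_add.1 heven).2 he)
  have := ih h.natDegree (by omega) hodd rfl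
  refine IsSemireal.not_isSumSq_neg_one (AdjoinRoot h) ?_
  have hGh : AdjoinRoot.mk h (G + 1) = 0 := AdjoinRoot.mk_eq_zero.2 (hh ▸ dvd_mul_left h f)
  rw [map_add, map_one] at hGh
  exact eq_neg_of_add_eq_zero_left hGh ▸ isSumSq_map _ hG

theorem exists_isSumSq_eq_mk_of_isSumSq_adjoinRoot_X_sq_sub_C {R : Type*} [CommRing R]
    [Nontrivial R] {a : R} {z : AdjoinRoot (X ^ 2 - C a)} (hz : IsSumSq z) :
    ∃ c₁ c₂ y, IsSumSq c₁ ∧ IsSumSq c₂ ∧ z = AdjoinRoot.mk _ (C (c₁ + a * c₂) + C y * X) := by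
  have hX : AdjoinRoot.mk (X ^ 2 - C a) X ^ 2 = AdjoinRoot.mk (X ^ 2 - C a) (C a) := by
    rw [← map_pow, AdjoinRoot.mk_eq_mk]
  induction hz with
  | zero => exact ⟨0, 0, 0, .zero, .zero, by simp⟩
  | sq_add x _ ih =>
    obtain ⟨c₁, c₂, y, h₁, h₂, rfl⟩ := ih
    obtain ⟨g, rfl⟩ := AdjoinRoot.mk_surjective x
    have hm : (X ^ 2 - C a).Monic := monic_X_pow_sub_C a two_ne_zero
    obtain ⟨u, v, huv⟩ : ∃ u v, g %ₘ (X ^ 2 - C a) = C u * X + C v :=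
      exists_eq_X_add_C_of_natDegree_le_one
        (by have := natDegree_modByMonic_lt g hm
              (fun h => by simpa using congrArg natDegree h)
            rw [natDegree_X_pow_sub_C] at this; omega)
    refine ⟨v * v + c₁, u * u + c₂, 2 * u * v + y, .sq_add _ h₁, .sq_add _ h₂, ?_⟩
    have hg : AdjoinRoot.mk (X ^ 2 - C a) g = AdjoinRoot.mk (X ^ 2 - C a) (C u * X + C v) := by
      rw [← huv]
      conv_lhs => rw [← modByMonic_add_div g (X ^ 2 - C a)]
      simp
    rw [hg]
    simp only [map_add, map_mul, map_ofNat] at hX ⊢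
    linear_combination AdjoinRoot.mk (X ^ 2 - C a) (C u) ^ 2 * hX

theorem isSemireal_adjoinRoot_X_sq_sub_C [IsSemireal F] {a : F} (ha : ¬ IsSumSq (-a)) :
    IsSemireal (AdjoinRoot (X ^ 2 - C a)) := by
  refine .of_not_isSumSq_neg_one fun hneg => ha ?_
  obtain ⟨c₁, c₂, y, h₁, h₂, h⟩ := exists_isSumSq_eq_mk_of_isSumSq_adjoinRoot_X_sq_sub_C hneg
  have hc : c₁ + a * c₂ + 1 = 0 := by
    have hdvd : X ^ 2 - C a ∣ C y * X + C (c₁ + a * c₂ + 1) := by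
      rw [← AdjoinRoot.mk_eq_zero, C_add, C_1, ← add_assoc, map_add, add_comm (C y * X), ← h,
        map_one, neg_add_cancel]
    have hlt : (C y * X + C (c₁ + a * c₂ + 1)).degree < (X ^ 2 - C a).degree := by
      rw [degree_X_pow_sub_C two_pos]
      exact degree_linear_le.trans_lt (by norm_num)
    simpa using congrArg (coeff · 0) (eq_zero_of_dvd_of_degree_lt hdvd hlt)
  have hc₂ : c₂ ≠ 0 := by
    rintro rfl
    exact IsSemireal.not_isSumSq_neg_one F (by
      rw [mul_zero, add_zero] at hc
      rwa [← eq_neg_of_add_eq_zero_left hc])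
  have : -a = (1 + c₁) * c₂⁻¹ := by
    field_simp
    linear_combination -hc
  exact this ▸ (IsSumSq.one.add h₁).mul (isSumSq_inv h₂)

end AdjoinRoot

section RealClosure

open Polynomial IntermediateField

theorem exists_irreducible_dvd_odd_natDegree {R : Type*} [CommRing R] [IsDomain R] [WfDvdMonoid R]
    {f : R[X]} (hf : Odd f.natDegree) : ∃ g, g ∣ f ∧ Irreducible g ∧ Odd g.natDegree := by
  induction f using WfDvdMonoid.induction_on_irreducible with
  | zero => simp at hf
  | unit u hu => simp [natDegree_eq_zero_of_isUnit hu] at hf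
  | mul f g hf0 hg ih =>
    rcases Nat.even_or_odd g.natDegree with hev | hodd
    · rw [natDegree_mul hg.ne_zero hf0, Nat.odd_add'] at hf
      obtain ⟨h, hhf, hh⟩ := ih (by simpa [hev] using hf)
      exact ⟨h, hhf.mul_left g, hh⟩
    · exact ⟨g, dvd_mul_right g f, hg, hodd⟩

theorem exists_isSumSq_coe_eq_of_isSumSq_sSup {K E : Type*} [Field K] [Field E] [Algebra K E]
    {c : Set (IntermediateField K E)} (hc : DirectedOn (· ≤ ·) c) (hne : c.Nonempty)
    {z : ↥(sSup c)} (hz : IsSumSq z) : ∃ L ∈ c, ∃ w : L, IsSumSq w ∧ (w : E) = z := by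
  have hmem : ∀ x : ↥(sSup c), ∃ L ∈ c, (x : E) ∈ L := by
    rintro ⟨x, hx⟩
    have : Nonempty c := hne.to_subtype
    rw [← SetLike.mem_coe, sSup_eq_iSup', coe_iSup_of_directed hc.directed_val] at hx
    simpa using hx
  induction hz with
  | zero => exact hne.imp fun L hL => ⟨hL, 0, .zero, rfl⟩
  | sq_add x _ ih =>
    obtain ⟨L₁, hL₁, w, hw, hwz⟩ := ih
    obtain ⟨L₂, hL₂, hx⟩ := hmem x
    obtain ⟨L, hL, h₁, h₂⟩ := hc _ hL₁ _ hL₂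
    refine ⟨L, hL, ⟨x, h₂ hx⟩ * ⟨x, h₂ hx⟩ + inclusion h₁ w,
      .sq_add _ (isSumSq_map (inclusion h₁).toRingHom hw), ?_⟩
    simp [hwz]

theorem exists_maximal_isSemireal_intermediateField (F E : Type*) [Field F] [IsSemireal F]
    [Field E] [Algebra F E] :
    ∃ L : IntermediateField F E, Maximal (fun L : IntermediateField F E => IsSemireal L) L := by
  refine (zorn_le_nonempty₀ {L : IntermediateField F E | IsSemireal L} ?_ ⊥
    (isSemireal_of_ringHom (botEquiv F E).toRingEquiv.toRingHom)).imp fun _ h => h.2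
  intro c hc hchain L hL
  refine ⟨sSup c, .of_not_isSumSq_neg_one fun h => ?_, fun _ => le_sSup⟩
  obtain ⟨L, hL, w, hw, hw1⟩ := exists_isSumSq_coe_eq_of_isSumSq_sSup hchain.directedOn ⟨_, hL⟩ h
  have : IsSemireal L := hc hL
  have hw1 : w = -1 := Subtype.ext (by simpa using hw1)
  exact IsSemireal.not_isSumSq_neg_one L (hw1 ▸ hw)

/-- A formally real field all of whose formally real algebraic extensions are trivial. (For fields,
`IsSemireal` says that the field is formally real.) -/
def IsMaximalSemireal (R : Type u) [Field R] : Prop :=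
  IsSemireal R ∧ ∀ (S : Type u) [Field S] [Algebra R S] [Algebra.IsAlgebraic R S] [IsSemireal S],
    Function.Surjective (algebraMap R S)

theorem exists_isMaximalSemireal_algebra (F : Type u) [Field F] [IsSemireal F] :
    ∃ (R : Type u) (_ : Field R) (_ : Algebra F R), IsMaximalSemireal R := by
  obtain ⟨L, hL, hmax⟩ := exists_maximal_isSemireal_intermediateField F (AlgebraicClosure F)
  refine ⟨L, inferInstance, inferInstance, hL, fun S _ _ _ _ s => ?_⟩
  let ψ : S →ₐ[L] AlgebraicClosure F := IsAlgClosed.lift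
  have hS : IsSemireal (ψ.fieldRange.restrictScalars F) :=
    isSemireal_of_ringHom ψ.equivFieldRange.symm.toRingEquiv.toRingHom
  have hle : L ≤ ψ.fieldRange.restrictScalars F := fun x hx =>
    ψ.fieldRange.algebraMap_mem ⟨x, hx⟩
  have hs : ψ s ∈ L := hmax hS hle ⟨s, rfl⟩
  exact ⟨⟨ψ s, hs⟩, ψ.toRingHom.injective (ψ.commutes _)⟩

namespace IsMaximalSemireal

variable {R : Type u} [Field R]

theorem exists_isRoot (hR : IsMaximalSemireal R) {f : R[X]} (hf : Irreducible f)
    (h : IsSemireal (AdjoinRoot f)) : ∃ x, f.IsRoot x := by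
  have : Fact (Irreducible f) := ⟨hf⟩
  have : Module.Finite R (AdjoinRoot f) := (AdjoinRoot.powerBasis hf.ne_zero).finite
  obtain ⟨x, hx⟩ := hR.2 (AdjoinRoot f) (AdjoinRoot.root f)
  refine ⟨x, (AdjoinRoot.of f).injective ?_⟩
  have := AdjoinRoot.eval₂_root f
  rw [← hx] at this
  simpa [eval₂_at_apply] using this

theorem exists_isRoot_of_odd_natDegree (hR : IsMaximalSemireal R) {f : R[X]}
    (hf : Odd f.natDegree) : ∃ x, f.IsRoot x := by
  have := hR.1
  obtain ⟨g, hgf, hg, hgodd⟩ := exists_irreducible_dvd_odd_natDegree hf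
  obtain ⟨x, hx⟩ := hR.exists_isRoot hg (isSemireal_adjoinRoot_of_odd_natDegree hgodd)
  exact ⟨x, hx.dvd hgf⟩

theorem isSquare_of_not_isSumSq_neg (hR : IsMaximalSemireal R) {a : R} (ha : ¬ IsSumSq (-a)) :
    IsSquare a := by
  have := hR.1
  by_contra hsq
  have hirr : Irreducible (X ^ 2 - C a) := X_pow_sub_C_irreducible_of_prime Nat.prime_two
    fun b hb => hsq ⟨b, by rw [← hb, sq]⟩
  obtain ⟨x, hx⟩ := hR.exists_isRoot hirr (isSemireal_adjoinRoot_X_sq_sub_C ha)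
  exact hsq ⟨x, by simpa [IsRoot, sub_eq_zero, sq, eq_comm] using hx⟩

theorem isSquare_or_isSquare_neg (hR : IsMaximalSemireal R) (a : R) :
    IsSquare a ∨ IsSquare (-a) := by
  have := hR.1
  by_contra! h
  have hna := mt hR.isSquare_of_not_isSumSq_neg h.1
  have ha := mt hR.isSquare_of_not_isSumSq_neg h.2
  rw [not_not] at ha hna
  rw [neg_neg] at ha
  exact h.1 (eq_zero_of_isSumSq_of_isSumSq_neg ha hna ▸ .zero)

theorem isRealClosed (hR : IsMaximalSemireal R) : IsRealClosed R where
  toIsSemireal := hR.1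
  isSquare_or_isSquare_neg := hR.isSquare_or_isSquare_neg
  exists_isRoot_of_odd_natDegree := hR.exists_isRoot_of_odd_natDegree

end IsMaximalSemireal

/-- The cone of sums of squares of a formally real field; it is the set of nonnegative elements of
the order on a real closed field. -/
def sumSqCone (F : Type*) [Field F] [IsSemireal F] : RingCone F where
  __ := Subsemiring.sumSq F
  eq_zero_of_mem_of_neg_mem' ha hna :=
    eq_zero_of_isSumSq_of_isSumSq_neg (Subsemiring.mem_sumSq.1 ha) (Subsemiring.mem_sumSq.1 hna)

theorem mem_sumSqCone {F : Type*} [Field F] [IsSemireal F] {a : F} :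
    a ∈ sumSqCone F ↔ IsSumSq a := Subsemiring.mem_sumSq

theorem exists_linearOrder_isStrictOrderedRing (R : Type*) [Field R] [IsRealClosed R] :
    ∃ _ : LinearOrder R, IsStrictOrderedRing R := by
  let inst : LinearOrder R :=
    { PartialOrder.mkOfAddGroupCone (sumSqCone R) with
      le_total a b := by
        rcases IsRealClosed.isSquare_or_isSquare_neg (b - a) with h | h
        · exact .inl (mem_sumSqCone.2 h.isSumSq)
        · exact .inr (mem_sumSqCone.2 (neg_sub b a ▸ h.isSumSq))
      toDecidableLE := Classical.decRel _ }
  have : IsOrderedRing R := .mkOfCone (sumSqCone R)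
  exact ⟨inst, IsOrderedRing.toIsStrictOrderedRing R⟩

theorem exists_ringHom_isRealClosed (F : Type u) [Field F] [IsSemireal F] :
    ∃ (R : Type u) (_ : Field R) (_ : LinearOrder R),
      IsStrictOrderedRing R ∧ IsRealClosed R ∧ Nonempty (F →+* R) := by
  obtain ⟨R, _, _, hR⟩ := exists_isMaximalSemireal_algebra F
  have := hR.isRealClosed
  obtain ⟨_, _⟩ := exists_linearOrder_isStrictOrderedRing R
  exact ⟨R, inferInstance, inferInstance, inferInstance, inferInstance, ⟨algebraMap F R⟩⟩

/-- An element which is not a sum of squares is made negative by adjoining a square root of its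
negative. -/
theorem exists_ringHom_isRealClosed_lt_zero {F : Type u} [Field F] (h2 : (2 : F) ≠ 0) {b : F}
    (hb : ¬ IsSumSq b) :
    ∃ (R : Type u) (_ : Field R) (_ : LinearOrder R),
      IsStrictOrderedRing R ∧ IsRealClosed R ∧ ∃ φ : F →+* R, φ b < 0 := by
  have := isSemireal_of_not_isSumSq h2 hb
  obtain ⟨K, _, _, ψ, s, hs⟩ : ∃ (K : Type u) (_ : Field K) (_ : IsSemireal K) (ψ : F →+* K)
      (s : K), ψ b = -(s * s) := by
    by_cases hsq : IsSquare (-b)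
    · obtain ⟨s, hs⟩ := hsq
      exact ⟨F, inferInstance, inferInstance, .id F, s, by rw [← hs, neg_neg, RingHom.id_apply]⟩
    · have : Fact (Irreducible (X ^ 2 - C (-b))) :=
        ⟨X_pow_sub_C_irreducible_of_prime Nat.prime_two fun c hc => hsq ⟨c, by rw [← hc, sq]⟩⟩
      refine ⟨AdjoinRoot (X ^ 2 - C (-b)), inferInstance,
        isSemireal_adjoinRoot_X_sq_sub_C (by rwa [neg_neg]), AdjoinRoot.of _,
        AdjoinRoot.root _, ?_⟩
      have hroot := AdjoinRoot.eval₂_root (X ^ 2 - C (-b))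
      rw [eval₂_sub, eval₂_pow, eval₂_X, eval₂_C] at hroot
      linear_combination hroot + map_neg (AdjoinRoot.of (X ^ 2 - C (-b))) b
  obtain ⟨R, _, _, _, _, ⟨χ⟩⟩ := exists_ringHom_isRealClosed K
  refine ⟨R, inferInstance, inferInstance, inferInstance, inferInstance, χ.comp ψ, ?_⟩
  have hb0 : χ (ψ b) ≠ 0 := (map_ne_zero (χ.comp ψ)).2 fun h0 => hb (h0 ▸ .zero)
  refine lt_of_le_of_ne ?_ hb0
  rw [RingHom.comp_apply, hs, map_neg, map_mul, neg_nonpos]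
  exact mul_self_nonneg _

end RealClosure

section Multiplicity

theorem exists_isSumSq_algebraMap_eq_mul {A B : Type*} [CommSemiring A] [CommSemiring B]
    [Algebra A B] (S : Submonoid A) [IsLocalization S B] {z : B} (hz : IsSumSq z) :
    ∃ (b : S) (c : A), IsSumSq c ∧ algebraMap A B c = algebraMap A B (b * b) * z := by
  induction hz with
  | zero => exact ⟨1, 0, .zero, by simp⟩
  | sq_add x _ ih =>
    obtain ⟨b, c, hc, hbc⟩ := ih
    obtain ⟨⟨r, m⟩, hrm⟩ := IsLocalization.surj S x
    refine ⟨m * b, b * r * (b * r) + m * m * c, .sq_add _ ((IsSumSq.mul_self _).mul hc), ?_⟩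
    simp only [map_add, map_mul, Submonoid.coe_mul, hbc, ← hrm]
    ring

namespace RealSpectrum

variable {A : Type u} [CommRing A]

theorem mem_supp {α : RealSpectrum A} {a : A} : a ∈ α.supp ↔ a ∈ α.1 ∧ -a ∈ α.1 := Iff.rfl

theorem mem_or_neg_mem (α : RealSpectrum A) (a : A) : a ∈ α.1 ∨ -a ∈ α.1 :=
  HasMemOrNegMem.mem_or_neg_mem α.1 a

theorem two_notMem_supp (α : RealSpectrum A) : (2 : A) ∉ α.supp := fun h => by
  have : (-1 : A) = 1 + -2 := by ring
  exact α.1.neg_one_notMem (this ▸ add_mem (one_mem α.1) h.2)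

theorem add_notMem_supp {α : RealSpectrum A} {b c : A} (hb : b ∈ α.1) (hc : c ∈ α.1)
    (hb' : b ∉ α.supp) : b + c ∉ α.supp := fun h => hb' <| mem_supp.2 ⟨hb, by
  have : -b = c + -(b + c) := by ring
  exact this ▸ add_mem hc h.2⟩

variable {α : RealSpectrum A} {p : A}

theorem exists_pow_two_mul_add_eq (hα : α.supp = Ideal.span {p}) {k l : ℕ} (hkl : k ≤ l) {b c : A}
    (hb : b ∈ α.1) (hc : c ∈ α.1) (hpb : ¬ p ∣ b) :
    ∃ w ∈ α.1, ¬ p ∣ w ∧ p ^ (2 * k) * b + p ^ (2 * l) * c = p ^ (2 * k) * w := by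
  obtain ⟨j, rfl⟩ := Nat.exists_eq_add_of_le hkl
  have hjc : p ^ (2 * j) * c ∈ α.1 :=
    mul_mem (α.1.mem_of_isSquare ((even_two_mul j).isSquare_pow p)) hc
  refine ⟨b + p ^ (2 * j) * c, add_mem hb hjc, ?_, by ring⟩
  rw [← Ideal.mem_span_singleton, ← hα] at hpb ⊢
  exact add_notMem_supp hb hjc hpb

variable [IsDomain A] [WfDvdMonoid A]

theorem exists_eq_pow_two_mul_mul_of_isSumSq (hα : α.supp = Ideal.span {p}) (hp : Prime p) {a : A}
    (ha : IsSumSq a) (ha0 : a ≠ 0) : ∃ k, ∃ w ∈ α.1, ¬ p ∣ w ∧ a = p ^ (2 * k) * w := by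
  induction ha with
  | zero => exact absurd rfl ha0
  | @sq_add x s _ ih =>
    rcases eq_or_ne x 0 with rfl | hx
    · simpa using ih (by simpa using ha0)
    obtain ⟨u, hu, hpu⟩ := (FiniteMultiplicity.of_prime_left hp hx).exists_eq_pow_mul_and_not_dvd
    have hpuu : ¬ p ∣ u * u := fun h => hpu ((hp.dvd_or_dvd h).elim id id)
    have huu : u * u ∈ α.1 := α.1.mem_of_isSquare (.mul_self u)
    have hxx : x * x = p ^ (2 * multiplicity p x) * (u * u) := by
      conv_lhs => rw [hu]
      ring
    rw [hxx]
    rcases eq_or_ne s 0 with rfl | hs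
    · exact ⟨_, u * u, huu, hpuu, add_zero _⟩
    obtain ⟨l, w, hw, hpw, rfl⟩ := ih hs
    rcases le_total (multiplicity p x) l with hle | hle
    · exact ⟨_, exists_pow_two_mul_add_eq hα hle huu hw hpuu⟩
    · rw [add_comm]
      exact ⟨_, exists_pow_two_mul_add_eq hα hle hw huu hpw⟩

theorem even_multiplicity_of_isSumSq (hα : α.supp = Ideal.span {p}) (hp : Prime p) {a : A}
    (ha : IsSumSq a) (ha0 : a ≠ 0) : Even (multiplicity p a) := by
  obtain ⟨k, w, -, hpw, rfl⟩ := exists_eq_pow_two_mul_mul_of_isSumSq hα hp ha ha0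
  rw [multiplicity_mul hp (.of_prime_left hp ha0), multiplicity_pow_self_of_prime hp,
    multiplicity_eq_zero.2 hpw]
  exact even_two_mul k

theorem even_multiplicity_of_isSumSq_algebraMap (hα : α.supp = Ideal.span {p}) (hp : Prime p)
    (K : Type*) [CommRing K] [Algebra A K] [IsFractionRing A K] {a : A} (ha0 : a ≠ 0)
    (ha : IsSumSq (algebraMap A K a)) : Even (multiplicity p a) := by
  obtain ⟨b, c, hc, hbc⟩ := exists_isSumSq_algebraMap_eq_mul (nonZeroDivisors A) ha
  have hb0 : (b : A) ≠ 0 := nonZeroDivisors.coe_ne_zero b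
  obtain rfl : c = b * b * a := IsFractionRing.injective A K (by simpa using hbc)
  have hba0 : b * b * a ≠ 0 := mul_ne_zero (mul_ne_zero hb0 hb0) ha0
  have heven := even_multiplicity_of_isSumSq hα hp hc hba0
  rw [multiplicity_mul hp (.of_prime_left hp hba0),
    multiplicity_mul hp (.of_prime_left hp (mul_ne_zero hb0 hb0))] at heven
  exact (Nat.even_add.1 heven).1 ⟨_, rfl⟩

end RealSpectrum

end Multiplicity

section QuadraticForm

open Matrix

theorem IsPsdOnRealSpectrum.isSumSq_map {A : Type u} [CommRing A] {n : ℕ}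
    {M : Matrix (Fin n) (Fin n) A} (hM : IsPsdOnRealSpectrum M) {K : Type u} [Field K]
    (h2 : (2 : K) ≠ 0) (φ : A →+* K) (v : Fin n → A) : IsSumSq (φ (v ⬝ᵥ M *ᵥ v)) := by
  by_contra hb
  obtain ⟨R, _, _, _, _, ψ, hψ⟩ := exists_ringHom_isRealClosed_lt_zero h2 hb
  refine hψ.not_ge ?_
  rw [← RingHom.comp_apply, RingHom.map_dotProduct,
    show ψ.comp φ ∘ (M *ᵥ v) = _ from funext fun _ => RingHom.map_mulVec _ _ _ _]
  exact hM R (ψ.comp φ) (ψ.comp φ ∘ v)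

section Matrix

variable {A ι : Type*} [CommRing A] [Fintype ι]

theorem add_dotProduct_mulVec_add_of_isSymm {M : Matrix ι ι A} (hM : M.IsSymm) (x y : ι → A) :
    (x + y) ⬝ᵥ M *ᵥ (x + y) = x ⬝ᵥ M *ᵥ x + y ⬝ᵥ M *ᵥ y + 2 * (y ⬝ᵥ M *ᵥ x) := by
  have hxy : x ⬝ᵥ M *ᵥ y = y ⬝ᵥ M *ᵥ x := by
    conv_lhs => rw [← hM.eq]
    exact dotProduct_transpose_mulVec M x y
  rw [mulVec_add, dotProduct_add, add_dotProduct, add_dotProduct, hxy]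
  ring

theorem exists_dvd_dotProduct_mulVec_self_and_eq [DecidableEq ι] {M P Q : Matrix ι ι A}
    {e : ι → A} (hP : IsUnit P.det) (hQ : IsUnit Q.det) (h : M = P * diagonal e * Q) (i : ι) :
    ∃ x y, e i ∣ x ⬝ᵥ M *ᵥ x ∧ e i ∣ y ⬝ᵥ M *ᵥ y ∧ y ⬝ᵥ M *ᵥ x = e i := by
  have hx : M *ᵥ Q⁻¹ *ᵥ Pi.single i 1 = e i • P *ᵥ Pi.single i 1 := by
    rw [h, mulVec_mulVec, mul_assoc, mul_nonsing_inv _ hQ, mul_one, ← mulVec_mulVec,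
      diagonal_mulVec_single, ← smul_eq_mul, Pi.single_smul', mulVec_smul]
  have hy : Pi.single i 1 ᵥ* P⁻¹ ᵥ* M = e i • Pi.single i 1 ᵥ* Q := by
    rw [h, vecMul_vecMul, mul_assoc P, ← mul_assoc, nonsing_inv_mul _ hP, one_mul, ← vecMul_vecMul,
      single_vecMul_diagonal, mul_comm, ← smul_eq_mul, Pi.single_smul', smul_vecMul]
  refine ⟨Q⁻¹ *ᵥ Pi.single i 1, Pi.single i 1 ᵥ* P⁻¹, ?_, ?_, ?_⟩
  · rw [hx, dotProduct_smul, smul_eq_mul]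
    exact dvd_mul_right _ _
  · rw [dotProduct_mulVec, hy, smul_dotProduct, smul_eq_mul]
    exact dvd_mul_right _ _
  · rw [dotProduct_mulVec, hy, smul_dotProduct, dotProduct_mulVec, vecMul_vecMul,
      mul_nonsing_inv _ hQ, vecMul_one, single_one_dotProduct, Pi.single_eq_same, smul_eq_mul,
      mul_one]

end Matrix

variable {A : Type u} [CommRing A] [IsDomain A] [WfDvdMonoid A]

theorem IsPsdOnRealSpectrum.even_multiplicity {n : ℕ} {M : Matrix (Fin n) (Fin n) A}
    (hpsd : IsPsdOnRealSpectrum M) {α : RealSpectrum A} {p : A} (hα : α.supp = Ideal.span {p})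
    (hp : Prime p) (v : Fin n → A) (hv : v ⬝ᵥ M *ᵥ v ≠ 0) :
    Even (multiplicity p (v ⬝ᵥ M *ᵥ v)) := by
  have h2 : (2 : FractionRing A) ≠ 0 := by
    rw [← map_ofNat (algebraMap A (FractionRing A)) 2]
    exact (map_ne_zero_iff _ (IsFractionRing.injective A _)).2 fun h =>
      α.two_notMem_supp (h ▸ α.supp.zero_mem)
  exact RealSpectrum.even_multiplicity_of_isSumSq_algebraMap hα hp (FractionRing A) hv
    (hpsd.isSumSq_map h2 _ v)

/-- Applied to `x`, `y` and `x + y`, an odd multiplicity of `p` in `e i` makes `p` divide the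
cofactors `s`, `t` and `s + t + 2`, hence `2`. -/
theorem even_multiplicity_of_isPsdOnRealSpectrum {n : ℕ} {M : Matrix (Fin n) (Fin n) A}
    (hM : M.IsSymm) (hpsd : IsPsdOnRealSpectrum M) {e : Fin n → A}
    (hsmith : MatrixEquivalent M (diagonal e)) {α : RealSpectrum A} {p : A}
    (hα : α.supp = Ideal.span {p}) (hp : Prime p) {i : Fin n} (hi : e i ≠ 0) :
    Even (multiplicity p (e i)) := by
  obtain ⟨P, Q, hP, hQ, h⟩ := hsmith
  obtain ⟨x, y, ⟨s, hx⟩, ⟨t, hy⟩, hyx⟩ := exists_dvd_dotProduct_mulVec_self_and_eq hP hQ h i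
  by_contra hodd
  have hdvd : ∀ (v : Fin n → A) (g : A), v ⬝ᵥ M *ᵥ v = e i * g → p ∣ g := by
    intro v g hg
    by_contra hpg
    have hne : e i * g ≠ 0 := mul_ne_zero hi fun h0 => hpg (h0 ▸ dvd_zero p)
    have heven := hpsd.even_multiplicity hα hp v (hg ▸ hne)
    rw [hg, multiplicity_mul hp (.of_prime_left hp hne), multiplicity_eq_zero.2 hpg] at heven
    exact hodd heven
  have hxy : (x + y) ⬝ᵥ M *ᵥ (x + y) = e i * (s + t + 2) := by
    rw [add_dotProduct_mulVec_add_of_isSymm hM, hx, hy, hyx]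
    ring
  have h2 : p ∣ 2 := (dvd_add_right (dvd_add (hdvd x s hx) (hdvd y t hy))).1 (hdvd _ _ hxy)
  exact α.two_notMem_supp (hα ▸ Ideal.mem_span_singleton.2 h2)

end QuadraticForm

section UniqueFactorization

theorem forall_isNonneg_or_forall_isNonneg_neg {A : Type u} [CommRing A] {a : A}
    (ha : ¬ ChangesSign a) :
    (∀ α : RealSpectrum A, α.IsNonneg a) ∨ ∀ α : RealSpectrum A, α.IsNonneg (-a) := by
  by_contra! h
  obtain ⟨⟨α, hα⟩, β, hβ⟩ := h
  exact ha ⟨β, α, ⟨(β.mem_or_neg_mem a).resolve_right hβ, fun h => hβ h.2⟩,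
    (α.mem_or_neg_mem a).resolve_left hα, fun h => hα (neg_neg a ▸ h.2)⟩

theorem exists_associated_forall_isNonneg_of_not_changesSign {A : Type u} [CommRing A]
    (hPNRI : PNRI A) {p : A} (hp : Irreducible p) (h : ¬ (IsRealIrreducible p ∧ ChangesSign p)) :
    ∃ q, Associated p q ∧ ∀ α : RealSpectrum A, α.IsNonneg q := by
  by_cases hreal : IsSemireal (A ⧸ Ideal.span {p})
  · rcases forall_isNonneg_or_forall_isNonneg_neg fun hs => h ⟨⟨hp, hreal⟩, hs⟩ with hnn | hnn
    · exact ⟨p, .refl p, hnn⟩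
    · exact ⟨-p, (Associated.refl p).neg_right, hnn⟩
  · obtain ⟨q, hpq, -, hq⟩ := hPNRI p ⟨hp, hreal⟩
    exact ⟨q, hpq, fun α => (hq α).1⟩

theorem exists_associated_pow_forall_isNonneg {A : Type u} [CommRing A]
    (hPNRI : PNRI A) {p : A} (hp : Irreducible p) {k : ℕ}
    (hk : IsRealIrreducible p → ChangesSign p → Even k) :
    ∃ q, Associated (p ^ k) q ∧ ∀ α : RealSpectrum A, α.IsNonneg q := by
  by_cases h : IsRealIrreducible p ∧ ChangesSign p
  · exact ⟨p ^ k, .refl _, fun α => α.1.mem_of_isSquare ((hk h.1 h.2).isSquare_pow p)⟩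
  · obtain ⟨q, hpq, hq⟩ := exists_associated_forall_isNonneg_of_not_changesSign hPNRI hp h
    exact ⟨q ^ k, hpq.pow_pow, fun α => pow_mem (hq α) k⟩

variable {A : Type u} [CommRing A] [IsDomain A] [UniqueFactorizationMonoid A]

theorem even_multiplicity_of_isRelPrime_of_even_multiplicity_mul {p a b : A} (hp : Prime p)
    (hab : IsRelPrime a b) (h0 : a * b ≠ 0) (h : Even (multiplicity p (a * b))) :
    Even (multiplicity p a) := by
  by_cases ha : p ∣ a
  · have hb : ¬ p ∣ b := fun hb => hp.not_isUnit (hab ha hb)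
    rwa [multiplicity_mul hp (.of_prime_left hp h0), multiplicity_eq_zero.2 hb] at h
  · rw [multiplicity_eq_zero.2 ha]
    exact .zero

theorem exists_associated_forall_isNonneg (hPNRI : PNRI A) {d : A} (hd0 : d ≠ 0)
    (hd : ∀ p, IsRealIrreducible p → ChangesSign p → Even (multiplicity p d)) :
    ∃ d', Associated d d' ∧ ∀ α : RealSpectrum A, α.IsNonneg d' := by
  induction d using UniqueFactorizationMonoid.induction_on_coprime with
  | h0 => exact absurd rfl hd0
  | h1 hx => exact ⟨1, associated_one_iff_isUnit.2 hx, fun α => one_mem α.1⟩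
  | @hpr p k hp =>
    refine exists_associated_pow_forall_isNonneg hPNRI hp.irreducible fun hreal hs => ?_
    simpa only [multiplicity_pow_self_of_prime hp] using hd p hreal hs
  | @hcp a b hab iha ihb =>
    obtain ⟨a', ha', hna⟩ := iha (left_ne_zero_of_mul hd0) fun p hp hs =>
      even_multiplicity_of_isRelPrime_of_even_multiplicity_mul hp.1.prime hab hd0 (hd p hp hs)
    obtain ⟨b', hb', hnb⟩ := ihb (right_ne_zero_of_mul hd0) fun p hp hs =>
      even_multiplicity_of_isRelPrime_of_even_multiplicity_mul hp.1.prime hab.symm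
        (mul_comm a b ▸ hd0) (mul_comm a b ▸ hd p hp hs)
    exact ⟨a' * b', ha'.mul_mul hb', fun α => mul_mem (hna α) (hnb α)⟩

theorem mainTheorem1_general {n : ℕ} {M : Matrix (Fin n) (Fin n) A} (hM : M.IsSymm)
    (hpsd : IsPsdOnRealSpectrum M) {e : Fin n → A}
    (hsmith : MatrixEquivalent M (Matrix.diagonal e)) (hPNRI : PNRI A) (i : Fin n)
    (hreal : ∀ p, IsRealIrreducible p → p ∣ e i → ChangesSign p →
      ∃ α : RealSpectrum A, α.supp = Ideal.span {p}) :
    ∃ d', Associated (e i) d' ∧ ∀ α : RealSpectrum A,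
      α.IsNonneg d' ∧ (e i ∉ α.supp → α.IsPos d') := by
  obtain ⟨d', hd', hnonneg⟩ :
      ∃ d', Associated (e i) d' ∧ ∀ α : RealSpectrum A, α.IsNonneg d' := by
    rcases eq_or_ne (e i) 0 with h0 | h0
    · exact ⟨0, h0 ▸ .refl _, fun α => zero_mem α.1⟩
    refine exists_associated_forall_isNonneg hPNRI h0 fun p hp hs => ?_
    by_cases hpe : p ∣ e i
    · obtain ⟨α, hα⟩ := hreal p hp hpe hs
      exact even_multiplicity_of_isPsdOnRealSpectrum hM hpsd hsmith hα hp.1.prime h0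
    · exact multiplicity_eq_zero.2 hpe ▸ .zero
  exact ⟨d', hd', fun α => ⟨hnonneg α, fun hi => ⟨hnonneg α, fun h => hi <|
    α.supp.mem_of_dvd hd'.symm.dvd h⟩⟩⟩

end UniqueFactorization

theorem mainTheorem1 {A : Type u} [CommRing A] [IsDomain A] [UniqueFactorizationMonoid A]
    [IsRegularRing A] {n : ℕ} (M : Matrix (Fin n) (Fin n) A) (hM : M.IsSymm)
    (hpsd : IsPsdOnRealSpectrum M) {r : ℕ} (hr : r ≤ n) (d : Fin r → A)
    (hdvd : ∀ i j : Fin r, i ≤ j → d i ∣ d j) (hsmith : MatrixEquivalent M (diagZero n d))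
    (hPNRI : PNRI A)
    (hGRI : ∀ p : A, IsRealIrreducible p → (∃ k, p ∣ d k) → ChangesSign p → GRI p) :
    ∀ k : Fin r, ∃ d' : A, Associated (d k) d' ∧ ∀ α : RealSpectrum A,
      α.IsNonneg d' ∧ (d k ∉ α.supp → α.IsPos d') := by
  intro k
  simpa [k.2] using mainTheorem1_general hM hpsd hsmith hPNRI ⟨k, k.2.trans_le hr⟩
    fun p hp hpk hs => (hGRI p hp ⟨k, by simpa using hpk⟩ hs).imp fun α hα => hα.choose_spec.1
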